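/- Let $a,b\in\mathbb{Q}$ with $4a^3+27b^2\neq 0$, let $E: y^2=x^3+ax+b$ be the corresponding elliptic curve over $\mathbb{Q}$ with origin $\mathcal{O}$, and let $P=(z,w)\in E(\mathbb{Q})\setminus\{\mathcal{O}\}$. Let $[2]^{-1}P=\{Q\in E(\overline{\mathbb{Q}}) : [2]Q=P\}$, a set of four points that is permuted by $\mathrm{Gal}(\overline{\mathbb{Q}}/\mathbb{Q})$ through its action on coordinates, and let $$\rho_{E,[2]^{-1}P}:\mathrm{Gal}(\overline{\mathbb{Q}}/\mathbb{Q})\to \mathrm{Sym}([2]^{-1}P)\cong S_4$$ be the resulting representation. Suppose that $\rho_{E,[2]^{-1}P}$ is surjective. Let $L_P$ be the splitting field over $\mathbb{Q}$ of $$f_P(x)=x^8-8wx^6+6(2az+3b)x^4-(4a^3+27b^2).$$ Then there is an injective group homomorphism $$\mathrm{Gal}(L_P/\mathbb{Q})\hookrightarrow \mathrm{Hol}(Q_8)=Q_8\rtimes \mathrm{Aut}(Q_8),$$ where $Q_8$ is the quaternion group of order $8$ and $\mathrm{Aut}(Q_8)$ acts on $Q_8$ tautologically; moreover $\mathrm{Hol}(Q_8)$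 has order $192$. -/

import Mathlib

open WeierstrassCurve

namespace QuaternionOrigami

/-- The Weierstrass curve `y ^ 2 = x ^ 3 + a x + b` over `ℚ`. It is an elliptic curve exactly when
`WeierstrassCurve.IsElliptic` holds, that is when its discriminant is nonzero. -/
def shortCurve (a b : ℚ) : WeierstrassCurve ℚ where
  a₁ := 0
  a₂ := 0
  a₃ := 0
  a₄ := a
  a₆ := b

/-- The absolute Galois group of `ℚ`. -/
abbrev AbsGal : Type := Gal(AlgebraicClosure ℚ/ℚ)

open scoped Classical in
/-- The set `[n]⁻¹P` of all points `Q ∈ E(ℚ̄)` with `[n]Q = P`, for a rational point `P` of `E`. -/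
def preimages (E : WeierstrassCurve ℚ) (n : ℕ) (P : Affine.Point (E⁄ℚ)) :
    Set (Affine.Point (E⁄(AlgebraicClosure ℚ))) :=
  {Q | n • Q = Affine.Point.baseChange ℚ (AlgebraicClosure ℚ) P}

open scoped Classical in
/-- The set `[n]⁻¹P` is stable under the coordinatewise Galois action on `E(ℚ̄)`. -/
theorem map_mem_preimages (E : WeierstrassCurve ℚ) (n : ℕ) (P : Affine.Point (E⁄ℚ)) (σ : AbsGal)
    {Q : (Affine.Point (E⁄(AlgebraicClosure ℚ)))} (hQ : Q ∈ preimages E n P) :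
    Affine.Point.map σ.toAlgHom Q ∈ preimages E n P := by
  have h : n • Q = Affine.Point.baseChange ℚ (AlgebraicClosure ℚ) P := hQ
  change n • Affine.Point.map σ.toAlgHom Q = _
  rw [← map_nsmul, h, Affine.Point.map_baseChange]

open scoped Classical in
/-- The representation `ρ_{E,[n]⁻¹P}`: the absolute Galois group of `ℚ` acting, coordinatewise, by
permutations of the set `[n]⁻¹P`. -/
noncomputable def rho (E : WeierstrassCurve ℚ) (n : ℕ) (P : Affine.Point (E⁄ℚ)) :
    AbsGal →* Equiv.Perm (preimages E n P) :=
  MonoidHom.toHomPerm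
    { toFun := fun σ Q => ⟨Affine.Point.map σ.toAlgHom Q.1, map_mem_preimages E n P σ Q.2⟩
      map_one' := by
        funext Q
        apply Subtype.ext
        rcases Q with ⟨_ | _, _⟩ <;> rfl
      map_mul' := fun σ τ => by
        funext Q
        apply Subtype.ext
        rcases Q with ⟨_ | _, _⟩ <;> rfl }

open Polynomial in
/-- The polynomial `x⁸ - 8 w x⁶ + 6 (2 a z + 3 b) x⁴ - (4 a³ + 27 b²)`. -/
noncomputable def fPoly (a b z w : ℚ) : ℚ[X] :=
  X ^ 8 - C (8 * w) * X ^ 6 + C (6 * (2 * a * z + 3 * b)) * X ^ 4 - C (4 * a ^ 3 + 27 * b ^ 2)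

/-- The holomorph `G ⋊ Aut(G)` of a group `G`, for the tautological action of `Aut(G)` on `G`. -/
abbrev Holomorph (G : Type*) [Group G] : Type _ :=
  G ⋊[MonoidHom.id (MulAut G)] MulAut G

/-- The quaternion group `Q₈` of order `8`. -/
abbrev Q8 : Type := QuaternionGroup 2

end QuaternionOrigami

/-! A half of P is determined by the slope l of its tangent, and the four slopes are the roots of an
explicit quartic. The ordinates of the halves are the roots of a quartic g with f_P(x) = g(x²), so
f_P has roots ±r₀, …, ±r₃ with r_i² an ordinate, and Galois acts on them by signed permutations, a
group of order 384.

The determinant of the matrix (r_i^(2k+1)) is multiplied by the determinant of the signed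
permutation. Its square is ∏ r_i² · disc g, which is the square of a rational number
(`det_oddPowers_eq`), so the determinant is rational and only signed permutations of determinant 1
occur. Labelling the roots by ±1, ±i, ±j, ±k identifies these with the maps x ↦ g·α(x) of Hol(Q₈)
(`mem_range_holomorphPerm`).

Surjectivity enters only to make the ordinates distinct (`halfY_injective`): if two agreed, all four
would, and the shape of g forbids this. -/

namespace QuaternionOrigami

/-! ### Automorphisms and holomorph of Q₈. -/

open QuaternionGroup

/-- The map `Q₈ → Q₈` that sends the generators `a 1`, `xa 0` to `u`, `v`. -/
def genMap (u v : Q8) : Q8 → Q8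
  | .a i => u ^ (ZMod.val (n := 4) i)
  | .xa i => v * u ^ (ZMod.val (n := 4) i)

-- Non-commuting elements of Q₈ both square to -1 and conjugation by one inverts the other, so they
-- satisfy the defining relations of the generators.
set_option maxRecDepth 100000 in
theorem genMap_mul : ∀ u v : Q8, u * v ≠ v * u →
    ∀ x y : Q8, genMap u v (x * y) = genMap u v x * genMap u v y := by
  decide +kernel

set_option maxRecDepth 100000 in
theorem genMap_injective : ∀ u v : Q8, u * v ≠ v * u →
    ∀ x y : Q8, genMap u v x = genMap u v y → x = y := by
  decide +kernel

/-- Two non-commuting elements of `Q₈` determine an automorphism of `Q₈`. -/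
noncomputable def autOfPair (u v : Q8) (h : u * v ≠ v * u) : MulAut Q8 :=
  MulEquiv.ofBijective (MulHom.mk (genMap u v) (genMap_mul u v h))
    (Finite.injective_iff_bijective.1 fun x y => genMap_injective u v h x y)

theorem autOfPair_apply (u v : Q8) (h : u * v ≠ v * u) (x : Q8) :
    autOfPair u v h x = genMap u v x := rfl

theorem eq_genMap (α : MulAut Q8) (x : Q8) : α x = genMap (α (a 1)) (α (xa 0)) x := by
  have key : ∀ x : Q8, x = genMap (a 1) (xa 0) x := by decide +kernel
  conv_lhs => rw [key x]
  rcases x with i | i <;> simp only [genMap, map_pow, map_mul]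

/-- Automorphisms of `Q₈` correspond to pairs of non-commuting elements. -/
noncomputable def mulAutEquiv : MulAut Q8 ≃ {p : Q8 × Q8 // p.1 * p.2 ≠ p.2 * p.1} where
  toFun α := ⟨(α (a 1), α (xa 0)), fun h => by
    rw [← map_mul, ← map_mul] at h
    exact absurd (α.injective h) (by decide)⟩
  invFun p := autOfPair p.1.1 p.1.2 p.2
  left_inv α := by
    ext x
    exact (eq_genMap α x).symm
  right_inv p := by
    rcases p with ⟨⟨u, v⟩, h⟩
    refine Subtype.ext (Prod.ext ?_ ?_)
    · change u ^ 1 = u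
      exact pow_one u
    · change v * u ^ 0 = v
      rw [pow_zero, mul_one]

-- There are 6 choices of u of order 4, then 4 choices of v outside the subgroup generated by u.
set_option maxRecDepth 100000 in
theorem card_mulAut_Q8 : Nat.card (MulAut Q8) = 24 := by
  rw [Nat.card_congr mulAutEquiv, Nat.card_eq_fintype_card]
  decide +kernel

theorem card_holomorph_Q8 : Nat.card (Holomorph Q8) = 192 := by
  rw [SemidirectProduct.card, card_mulAut_Q8, Nat.card_eq_fintype_card, QuaternionGroup.card]

/-- The holomorph of a group acting on the group: `(g, α)` is the map `x ↦ g * α x`. -/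
def holomorphPerm (G : Type*) [Group G] : Holomorph G →* Equiv.Perm G :=
  SemidirectProduct.lift (MulAction.toPermHom G G) (MulAut.toPerm G) fun α => by
    ext g x
    change α g * x = α (g * α.symm x)
    rw [map_mul, MulEquiv.apply_symm_apply]

theorem holomorphPerm_apply {G : Type*} [Group G] (p : Holomorph G) (x : G) :
    holomorphPerm G p x = p.left * p.right x := rfl

theorem holomorphPerm_injective (G : Type*) [Group G] :
    Function.Injective (holomorphPerm G) := by
  intro p q h
  have key (x : G) : p.left * p.right x = q.left * q.right x := by
    simpa only [holomorphPerm_apply] using DFunLike.congr_fun h x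
  have hl : p.left = q.left := by simpa using key 1
  refine SemidirectProduct.ext hl (MulEquiv.ext fun x => ?_)
  have := key x
  rwa [hl, mul_right_inj] at this

/-! ### The holomorph as signed permutations of determinant one. -/

/-- The coordinates of an element of `Q₈ = {±1, ±i, ±j, ±k}` with respect to `1, i, j, k`. -/
def signVec : Q8 → Fin 4 → ℤ
  | .a i => ![![1, 0, 0, 0], ![0, 1, 0, 0], ![-1, 0, 0, 0], ![0, -1, 0, 0]] i
  | .xa i => ![![0, 0, 1, 0], ![0, 0, 0, 1], ![0, 0, -1, 0], ![0, 0, 0, -1]] i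

/-- The elements `1, i, j, k` of `Q₈`. -/
def basisQ8 : Fin 4 → Q8 := ![a 0, a 1, xa 0, xa 1]

/-- The Laplace expansion of a four by four determinant. -/
def detFour (p q r s : Fin 4 → ℤ) : ℤ :=
  (p 0 * q 1 - p 1 * q 0) * (r 2 * s 3 - r 3 * s 2)
  - (p 0 * q 2 - p 2 * q 0) * (r 1 * s 3 - r 3 * s 1)
  + (p 0 * q 3 - p 3 * q 0) * (r 1 * s 2 - r 2 * s 1)
  + (p 1 * q 2 - p 2 * q 1) * (r 0 * s 3 - r 3 * s 0)
  - (p 1 * q 3 - p 3 * q 1) * (r 0 * s 2 - r 2 * s 0)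
  + (p 2 * q 3 - p 3 * q 2) * (r 0 * s 1 - r 1 * s 0)

theorem det_eq_detFour (M : Matrix (Fin 4) (Fin 4) ℤ) :
    M.det = detFour (M 0) (M 1) (M 2) (M 3) := by
  simp [Matrix.det_succ_row_zero, Fin.sum_univ_succ, Fin.succAbove, detFour]
  ring

-- Left translation by x⁻¹ has determinant 1, so one may take x = 1. Then y and z are anticommuting
-- units, which leaves t = ±zy, and the determinant selects the sign. The order zy appears because
-- `xa 1 = xa 0 * a 1`.
set_option maxRecDepth 100000 in
theorem relations_of_detFour_eq_one : ∀ x y z t : Q8,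
    detFour (signVec x) (signVec y) (signVec z) (signVec t) = 1 →
    (x⁻¹ * y) * (x⁻¹ * z) ≠ (x⁻¹ * z) * (x⁻¹ * y) ∧ x⁻¹ * t = (x⁻¹ * z) * (x⁻¹ * y) := by
  decide +kernel

theorem exists_basisQ8 : ∀ x : Q8, ∃ i, x = basisQ8 i ∨ x = a 2 * basisQ8 i := by decide +kernel

theorem genMap_a_two : ∀ u v : Q8, u * v ≠ v * u → genMap u v (a 2) = a 2 := by decide +kernel

theorem a_two_mul : ∀ x : Q8, a 2 * x = x * a 2 := by decide +kernel

/-- A permutation of `Q₈` that commutes with `-1` and acts with determinant one on the coordinates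
belongs to the holomorph. -/
theorem mem_range_holomorphPerm (p : Equiv.Perm Q8) (hneg : ∀ x, p (a 2 * x) = a 2 * p x)
    (hdet : (Matrix.of fun i => signVec (p (basisQ8 i))).det = 1) :
    p ∈ (holomorphPerm Q8).range := by
  rw [det_eq_detFour] at hdet
  obtain ⟨hne, hk⟩ := relations_of_detFour_eq_one _ _ _ _ hdet
  refine ⟨⟨p (basisQ8 0), autOfPair _ _ hne⟩, Equiv.ext fun x => ?_⟩
  rw [holomorphPerm_apply]
  change p (basisQ8 0) * autOfPair _ _ hne x = p x
  have hb (i : Fin 4) : p (basisQ8 0) * autOfPair _ _ hne (basisQ8 i) = p (basisQ8 i) := by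
    rw [autOfPair_apply]
    fin_cases i
    · change _ * (_ ^ 0) = _
      rw [pow_zero, mul_one]
      rfl
    · change _ * (_ ^ 1) = _
      rw [pow_one, mul_inv_cancel_left]
      rfl
    · change _ * (_ * _ ^ 0) = _
      rw [pow_zero, mul_one, mul_inv_cancel_left]
      rfl
    · change _ * (_ * _ ^ 1) = _
      rw [pow_one, ← hk, mul_inv_cancel_left]
      rfl
  obtain ⟨i, rfl | rfl⟩ := exists_basisQ8 x
  · exact hb i
  · rw [map_mul, hneg, ← hb i, autOfPair_apply _ _ _ (a 2), genMap_a_two _ _ hne, ← mul_assoc,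
      ← mul_assoc, a_two_mul]

open QuaternionGroup

/-! ### Signed families ±r i and the determinant of their odd powers. -/

section Signed

variable {K : Type*} [Field K]

/-- The element `±r i` of a field attached to the element `±1, ±i, ±j, ±k` of `Q₈`. -/
def signedVal (r : Fin 4 → K) (x : Q8) : K := ∑ i, (signVec x i : K) * r i

theorem signVec_basisQ8 : ∀ i j : Fin 4, signVec (basisQ8 i) j = if i = j then 1 else 0 := by
  decide +kernel

theorem signedVal_basisQ8 (r : Fin 4 → K) (i : Fin 4) : signedVal r (basisQ8 i) = r i := by
  simp [signedVal, signVec_basisQ8]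

theorem signVec_neg : ∀ (x : Q8) (i : Fin 4), signVec (a 2 * x) i = - signVec x i := by
  decide +kernel

theorem signedVal_neg (r : Fin 4 → K) (x : Q8) : signedVal r (a 2 * x) = - signedVal r x := by
  simp [signedVal, signVec_neg]

/-- Odd powers respect signs; this is why the invariant is built from odd exponents only. -/
theorem signedVal_pow_odd (r : Fin 4 → K) (x : Q8) (k : ℕ) :
    signedVal r x ^ (2 * k + 1) = signedVal (fun i => r i ^ (2 * k + 1)) x := by
  have hodd : Odd (2 * k + 1) := ⟨k, rfl⟩
  obtain ⟨i, rfl | rfl⟩ := exists_basisQ8 x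
  · rw [signedVal_basisQ8, signedVal_basisQ8]
  · rw [signedVal_neg, signedVal_neg, hodd.neg_pow, signedVal_basisQ8, signedVal_basisQ8]

/-- The matrix of the odd powers `r i ^ (2 * k + 1)`. -/
def oddPowers (r : Fin 4 → K) : Matrix (Fin 4) (Fin 4) K := Matrix.of fun i k => r i ^ (2 * k.1 + 1)

theorem det_oddPowers (r : Fin 4 → K) :
    (oddPowers r).det = (∏ i, r i) * (Matrix.vandermonde fun i => r i ^ 2).det := by
  rw [← Matrix.det_mul_column]
  congr 1
  ext i k
  simp only [oddPowers, Matrix.vandermonde_apply, Matrix.of_apply]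
  ring

/-- The matrix of the signed family is the integer sign matrix times the original matrix. -/
theorem det_oddPowers_signedVal (r : Fin 4 → K) (x : Fin 4 → Q8) :
    (oddPowers fun i => signedVal r (x i)).det =
      ((Matrix.of fun i => signVec (x i)).det : ℤ) * (oddPowers r).det := by
  rw [show (((Matrix.of fun i => signVec (x i)).det : ℤ) : K) = _ from
    (Int.castRingHom K).map_det _, ← Matrix.det_mul]
  congr 1
  ext i k
  simp only [oddPowers, Matrix.of_apply, signedVal_pow_odd, Matrix.mul_apply]
  rfl

variable {r : Fin 4 → K}

theorem signedVal_injective (h2 : (2 : K) ≠ 0) (h0 : ∀ i, r i ≠ 0)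
    (hinj : Function.Injective fun i => r i ^ 2) : Function.Injective (signedVal r) := by
  have hneg (i j : Fin 4) : r i ≠ - r j := fun h => by
    obtain rfl : i = j := hinj (by simp [h])
    have h' : 2 * r i = 0 := by linear_combination h
    exact h0 i ((mul_eq_zero.1 h').resolve_left h2)
  have hpos {i j : Fin 4} (h : r i = r j) : i = j := hinj (by simp [h])
  intro x y h
  obtain ⟨i, rfl | rfl⟩ := exists_basisQ8 x <;> obtain ⟨j, rfl | rfl⟩ := exists_basisQ8 y <;>
    simp only [signedVal_neg, signedVal_basisQ8] at h
  · rw [hpos h]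
  · exact absurd h (hneg i j)
  · exact absurd h.symm (hneg j i)
  · rw [hpos (neg_injective h)]

theorem exists_signedVal_iff (y : K) : (∃ x, signedVal r x = y) ↔ ∃ i, y ^ 2 = r i ^ 2 := by
  constructor
  · rintro ⟨x, rfl⟩
    obtain ⟨i, rfl | rfl⟩ := exists_basisQ8 x <;> refine ⟨i, ?_⟩ <;>
      simp only [signedVal_neg, signedVal_basisQ8, neg_sq]
  · rintro ⟨i, h⟩
    rcases sq_eq_sq_iff_eq_or_eq_neg.1 h with rfl | rfl
    · exact ⟨basisQ8 i, signedVal_basisQ8 r i⟩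
    · exact ⟨a 2 * basisQ8 i, by rw [signedVal_neg, signedVal_basisQ8]⟩

end Signed

/-! ### Galois groups of even octics with rational odd-power determinant. -/

instance normal_algebraicClosure_rat : Normal ℚ (AlgebraicClosure ℚ) := by
  have h := @IsAlgClosure.normal ℚ (AlgebraicClosure ℚ) _ _ (AlgebraicClosure.instAlgebra ℚ)
    inferInstance
  rwa [Subsingleton.elim (AlgebraicClosure.instAlgebra ℚ) DivisionRing.toRatAlgebra] at h

open Polynomial in
/-- A rational polynomial whose roots are `±r i` for four elements `r i` with distinct nonzero
squares, and for which the determinant of the odd powers of the `r i` is rational, has a Galois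
group that embeds into the holomorph of `Q₈`. -/
theorem exists_injective_hom_holomorph (f : ℚ[X]) (r : Fin 4 → AlgebraicClosure ℚ)
    (hf : ∀ y, y ∈ f.rootSet (AlgebraicClosure ℚ) ↔ ∃ i, y ^ 2 = r i ^ 2)
    (h0 : ∀ i, r i ≠ 0) (hinj : Function.Injective fun i => r i ^ 2)
    (hdet : ∃ q : ℚ, (oddPowers r).det = algebraMap ℚ _ q) :
    ∃ φ : Gal(f.SplittingField/ℚ) →* Holomorph Q8, Function.Injective φ := by
  have : Fact ((f.map (algebraMap ℚ (AlgebraicClosure ℚ))).Splits) :=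
    ⟨IsAlgClosed.splits _⟩
  have hsi := signedVal_injective two_ne_zero h0 hinj
  let e : Q8 ≃ f.rootSet (AlgebraicClosure ℚ) :=
    Equiv.ofBijective
      (fun x => ⟨signedVal r x, (hf _).2 ((exists_signedVal_iff _).1 ⟨x, rfl⟩)⟩)
      ⟨fun x y h => hsi (congrArg Subtype.val h), fun y => by
        obtain ⟨x, hx⟩ := (exists_signedVal_iff (r := r) y.1).2 ((hf _).1 y.2)
        exact ⟨x, Subtype.ext hx⟩⟩
  let ψ : f.Gal →* Equiv.Perm Q8 :=
    (e.symm.permCongrHom.toMonoidHom).comp (Gal.galActionHom f (AlgebraicClosure ℚ))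
  have hψ : Function.Injective ψ :=
    e.symm.permCongrHom.injective.comp (Gal.galActionHom_injective f _)
  have hrange (g : f.Gal) : ψ g ∈ (holomorphPerm Q8).range := by
    obtain ⟨σ, rfl⟩ := Gal.restrict_surjective f (AlgebraicClosure ℚ) g
    set p := ψ (Gal.restrict f (AlgebraicClosure ℚ) σ) with hp
    have hσ (x : Q8) : signedVal r (p x) = σ (signedVal r x) := by
      have h1 : e (p x) = Gal.galActionHom f _ (Gal.restrict f (AlgebraicClosure ℚ) σ) (e x) := by
        change e (e.symm _) = _
        rw [Equiv.apply_symm_apply]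
        rfl
      have h2 := congrArg Subtype.val h1
      rwa [Gal.galActionHom_restrict] at h2
    refine mem_range_holomorphPerm p (fun x => hsi ?_) ?_
    · rw [hσ, signedVal_neg, signedVal_neg, hσ, map_neg]
    · obtain ⟨q, hq⟩ := hdet
      have hne : (oddPowers r).det ≠ 0 := by
        rw [det_oddPowers]
        exact mul_ne_zero (Finset.prod_ne_zero_iff.2 fun i _ => h0 i)
          (Matrix.det_vandermonde_ne_zero_iff.2 hinj)
      -- Applying σ entrywise replaces each root by its image, while a rational determinant is
      -- fixed. Cancelling it leaves determinant 1 for the sign matrix.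
      have hfix : (oddPowers fun i => signedVal r (p (basisQ8 i))).det = (oddPowers r).det := by
        calc _ = (σ.toRingEquiv.toRingHom.mapMatrix (oddPowers r)).det := by
              congr 1
              ext i k
              simp only [oddPowers, Matrix.of_apply, hσ, signedVal_basisQ8]
              exact (map_pow σ _ _).symm
          _ = σ (oddPowers r).det := (RingHom.map_det _ _).symm
          _ = _ := by rw [hq, AlgEquiv.commutes]
      rw [det_oddPowers_signedVal] at hfix
      exact_mod_cast mul_right_cancel₀ hne (hfix.trans (one_mul _).symm)
  let Φ := MonoidHom.ofInjective (holomorphPerm_injective Q8)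
  refine ⟨Φ.symm.toMonoidHom.comp (ψ.codRestrict _ hrange), ?_⟩
  exact Φ.symm.injective.comp fun x y h => hψ (congrArg Subtype.val h)

/-! ### The quartics of tangent slopes and of ordinates. -/

section Quartic

variable {K : Type*} [Field K]

open Polynomial in
theorem exists_quartic_roots [IsAlgClosed K] (c₂ c₁ c₀ : K) :
    ∃ l : Fin 4 → K, ∀ x, x ^ 4 + c₂ * x ^ 2 + c₁ * x + c₀ = ∏ i, (x - l i) := by
  let p : K[X] := X ^ 4 + C c₂ * X ^ 2 + C c₁ * X + C c₀
  have hdeg : p.natDegree = 4 := by simp only [p]; compute_degree!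
  have hmonic : p.Monic := by simp only [p]; monicity!
  have hs := IsAlgClosed.splits p
  have hcard : p.roots.card = 4 := by rw [← hdeg, hs.natDegree_eq_card_roots]
  obtain ⟨l₀, l₁, l₂, l₃, hl⟩ := Multiset.card_eq_four.1 hcard
  refine ⟨![l₀, l₁, l₂, l₃], fun x => ?_⟩
  have h := congrArg (eval x) (hs.eq_prod_roots_of_monic hmonic)
  rw [hl] at h
  simpa [p, Fin.prod_univ_four, mul_assoc] using h

/-- The relations between the coefficients of a monic quartic and its roots. -/
theorem vieta_quartic [CharZero K] {c₃ c₂ c₁ c₀ : K} {l : Fin 4 → K}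
    (h : ∀ x, x ^ 4 + c₃ * x ^ 3 + c₂ * x ^ 2 + c₁ * x + c₀ = ∏ i, (x - l i)) :
    c₃ = -(l 0 + l 1 + l 2 + l 3) ∧
      c₂ = l 0 * l 1 + l 0 * l 2 + l 0 * l 3 + l 1 * l 2 + l 1 * l 3 + l 2 * l 3 ∧
      c₁ = -(l 0 * l 1 * l 2 + l 0 * l 1 * l 3 + l 0 * l 2 * l 3 + l 1 * l 2 * l 3) ∧
      c₀ = l 0 * l 1 * l 2 * l 3 := by
  simp only [Fin.prod_univ_four] at h
  -- The terms x⁴ cancel, so the difference of the two sides is a polynomial of degree at most 3,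
  -- determined by its values at four points.
  have h0 := h 0
  have h1 := h 1
  have h2 := h (-1)
  have h3 := h 2
  have h4 : c₃ = -(l 0 + l 1 + l 2 + l 3) := by
    linear_combination (1 / 6) * h3 - (1 / 2) * h1 + (1 / 2) * h0 - (1 / 6) * h2
  refine ⟨h4, ?_, ?_, ?_⟩
  · linear_combination (1 / 2) * h1 + (1 / 2) * h2 - h0
  · linear_combination (1 / 2) * h1 - (1 / 2) * h2 - h4
  · linear_combination h0

/-- The abscissa of the half of the point with coordinates `z`, `w` at which the tangent has
slope `l`. -/
def halfX (z l : K) : K := (l ^ 2 - z) / 2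

/-- The ordinate of the half of the point with coordinates `z`, `w` at which the tangent has
slope `l`. -/
def halfY (z w l : K) : K := (l ^ 3 - 3 * z * l - 2 * w) / 2

variable [CharZero K] {a b z w : K}

/-- For a half (u, v) with tangent slope l, the doubling formulas z = l² - 2u and w = -(v + l(z -
u)) give u = `halfX` and v = `halfY`. Tangency, 3u² + a = 2vl, then becomes the quartic in l. -/
theorem halfY_sq {l : K} (hw : w ^ 2 = z ^ 3 + a * z + b)
    (hl : l ^ 4 + (-6 * z) * l ^ 2 + (-8 * w) * l + (-3 * z ^ 2 - 4 * a) = 0) :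
    halfY z w l ^ 2 = halfX z l ^ 3 + a * halfX z l + b := by
  simp only [halfX, halfY]
  linear_combination (l ^ 2 / 8 - 3 * z / 8) * hl + hw

theorem tangent_slope {l : K}
    (hl : l ^ 4 + (-6 * z) * l ^ 2 + (-8 * w) * l + (-3 * z ^ 2 - 4 * a) = 0) :
    3 * halfX z l ^ 2 + a = l * (2 * halfY z w l) := by
  simp only [halfX, halfY]
  linear_combination (-1 / 4) * hl

/-- This writes z, w and a through l 0, l 1, l 2, so that later identities become polynomial
identities in free variables. -/
theorem slopes_vieta {l : Fin 4 → K}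
    (hl : ∀ x, x ^ 4 + (-6 * z) * x ^ 2 + (-8 * w) * x + (-3 * z ^ 2 - 4 * a) = ∏ i, (x - l i)) :
    l 3 = -(l 0 + l 1 + l 2) ∧
      z = (l 0 * l 1 + l 0 * l 2 + l 0 * l 3 + l 1 * l 2 + l 1 * l 3 + l 2 * l 3) / -6 ∧
      w = (l 0 * l 1 * l 2 + l 0 * l 1 * l 3 + l 0 * l 2 * l 3 + l 1 * l 2 * l 3) / 8 ∧
      a = (l 0 * l 1 * l 2 * l 3 + 3 * z ^ 2) / -4 := by
  obtain ⟨h3, h2, h1, h0⟩ := vieta_quartic (l := l) (c₃ := 0) (c₂ := -6 * z)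
    (c₁ := -8 * w) (c₀ := -3 * z ^ 2 - 4 * a) fun x => by rw [← hl x]; ring
  refine ⟨?_, ?_, ?_, ?_⟩
  · linear_combination h3
  · linear_combination (-1 / 6) * h2
  · linear_combination (-1 / 8) * h1
  · linear_combination (-1 / 4) * h0

theorem slopes_injective {l : Fin 4 → K} (hw : w ^ 2 = z ^ 3 + a * z + b)
    (hl : ∀ x, x ^ 4 + (-6 * z) * x ^ 2 + (-8 * w) * x + (-3 * z ^ 2 - 4 * a) = ∏ i, (x - l i))
    (hΔ : 4 * a ^ 3 + 27 * b ^ 2 ≠ 0) : Function.Injective l := by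
  -- The discriminant of the slope quartic is 256 times that of the curve.
  have key : ((l 0 - l 1) * (l 0 - l 2) * (l 0 - l 3) * (l 1 - l 2) * (l 1 - l 3) *
      (l 2 - l 3)) ^ 2 = -4096 * (4 * a ^ 3 + 27 * b ^ 2) := by
    obtain ⟨h3, h2, h1, h0⟩ := slopes_vieta hl
    have hb : b = w ^ 2 - z ^ 3 - a * z := by linear_combination -hw
    rw [hb, h0, h2, h1, h3]
    ring
  have hne := mul_ne_zero (neg_ne_zero.2 (by norm_num : (4096 : K) ≠ 0)) hΔ
  rw [← key] at hne
  intro i j hij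
  by_contra h
  apply hne
  fin_cases i <;> fin_cases j <;> simp_all

/-- The ordinates of the halves of a point are the roots of a quartic. -/
theorem prod_sub_halfY {l : Fin 4 → K} (hw : w ^ 2 = z ^ 3 + a * z + b)
    (hl : ∀ x, x ^ 4 + (-6 * z) * x ^ 2 + (-8 * w) * x + (-3 * z ^ 2 - 4 * a) = ∏ i, (x - l i))
    (y : K) :
    ∏ i, (y - halfY z w (l i)) =
      y ^ 4 - 8 * w * y ^ 3 + 6 * (2 * a * z + 3 * b) * y ^ 2 - (4 * a ^ 3 + 27 * b ^ 2) := by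
  obtain ⟨h3, h2, h1, h0⟩ := slopes_vieta hl
  have hb : b = w ^ 2 - z ^ 3 - a * z := by linear_combination -hw
  simp only [Fin.prod_univ_four, halfY]
  rw [hb, h0, h2, h1, h3]
  ring

/-- The discriminant of a monic quartic in terms of the elementary symmetric functions. -/
theorem disc_quartic {R : Type*} [CommRing R] (v : Fin 4 → R) (e₁ e₂ e₃ e₄ : R)
    (h₁ : e₁ = v 0 + v 1 + v 2 + v 3)
    (h₂ : e₂ = v 0 * v 1 + v 0 * v 2 + v 0 * v 3 + v 1 * v 2 + v 1 * v 3 + v 2 * v 3)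
    (h₃ : e₃ = v 0 * v 1 * v 2 + v 0 * v 1 * v 3 + v 0 * v 2 * v 3 + v 1 * v 2 * v 3)
    (h₄ : e₄ = v 0 * v 1 * v 2 * v 3) :
    (Matrix.vandermonde v).det ^ 2 =
      256 * e₄ ^ 3 - 192 * e₁ * e₃ * e₄ ^ 2 - 128 * e₂ ^ 2 * e₄ ^ 2 + 144 * e₂ * e₃ ^ 2 * e₄
        - 27 * e₃ ^ 4 + 144 * e₁ ^ 2 * e₂ * e₄ ^ 2 - 6 * e₁ ^ 2 * e₃ ^ 2 * e₄
        - 80 * e₁ * e₂ ^ 2 * e₃ * e₄ + 18 * e₁ * e₂ * e₃ ^ 3 + 16 * e₂ ^ 4 * e₄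
        - 4 * e₂ ^ 3 * e₃ ^ 2 - 27 * e₁ ^ 4 * e₄ ^ 2 + 18 * e₁ ^ 3 * e₂ * e₃ * e₄
        - 4 * e₁ ^ 3 * e₃ ^ 3 - 4 * e₁ ^ 2 * e₂ ^ 3 * e₄ + e₁ ^ 2 * e₂ ^ 2 * e₃ ^ 2 := by
  have hd : (Matrix.vandermonde v).det =
      (v 1 - v 0) * (v 2 - v 0) * (v 3 - v 0) * ((v 2 - v 1) * (v 3 - v 1)) * (v 3 - v 2) := by
    rw [Matrix.det_vandermonde, Fin.prod_univ_four,
      show Finset.Ioi (0 : Fin 4) = {1, 2, 3} from by decide,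
      show Finset.Ioi (1 : Fin 4) = {2, 3} from by decide,
      show Finset.Ioi (2 : Fin 4) = {3} from by decide,
      show Finset.Ioi (3 : Fin 4) = ∅ from by decide]
    simp [mul_assoc]
  rw [hd, h₁, h₂, h₃, h₄]
  ring

/-- The determinant of the odd powers of the roots of `fPoly` is rational in the parameters, up to
sign. -/
theorem det_oddPowers_eq {r : Fin 4 → K} (hw : w ^ 2 = z ^ 3 + a * z + b)
    (h : ∀ y, ∏ i, (y - r i ^ 2) =
      y ^ 4 - 8 * w * y ^ 3 + 6 * (2 * a * z + 3 * b) * y ^ 2 - (4 * a ^ 3 + 27 * b ^ 2)) :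
    (∏ i, r i ^ 2) = -(4 * a ^ 3 + 27 * b ^ 2) ∧
      (oddPowers r).det ^ 2 = ((4 * a ^ 3 + 27 * b ^ 2) *
        (64 * a ^ 3 + 576 * a ^ 2 * z ^ 2 - 1728 * b * z ^ 3)) ^ 2 := by
  obtain ⟨h₁, h₂, h₃, h₄⟩ := vieta_quartic (l := fun i => r i ^ 2) (c₃ := -(8 * w))
    (c₂ := 6 * (2 * a * z + 3 * b)) (c₁ := -0) (c₀ := -(4 * a ^ 3 + 27 * b ^ 2))
    fun y => by rw [h y]; ring
  refine ⟨by rw [h₄, Fin.prod_univ_four], ?_⟩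
  -- The squared determinant is ∏ r i ^ 2 times the discriminant of the ordinate quartic. Both
  -- factors are -(4a³ + 27b²) up to a square, so their product is a square.
  rw [det_oddPowers, mul_pow, ← Finset.prod_pow, Fin.prod_univ_four, ← h₄,
    disc_quartic _ _ _ _ _ (neg_injective h₁) h₂ (neg_injective h₃) h₄]
  have hb : b = w ^ 2 - z ^ 3 - a * z := by linear_combination -hw
  rw [hb]
  ring

end Quartic

/-! ### Halves of P on the curve and the Galois action on them. -/

theorem shortCurve_disc_ne_zero (a b : ℚ) [h : (shortCurve a b).IsElliptic] :
    4 * a ^ 3 + 27 * b ^ 2 ≠ 0 := by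
  have hu := h.isUnit.ne_zero
  intro h0
  apply hu
  simp only [WeierstrassCurve.Δ, b₂, b₄, b₆, b₈, shortCurve]
  linear_combination -16 * h0

theorem shortCurve_equation_iff {K : Type*} [Field K] [Algebra ℚ K] (a b : ℚ) (x y : K) :
    Affine.Equation ((shortCurve a b)⁄K) x y ↔
      y ^ 2 = x ^ 3 + algebraMap ℚ K a * x + algebraMap ℚ K b := by
  simp [Affine.equation_iff, shortCurve, baseChange]

open scoped Classical in
/-- A root of the slope quartic gives a half of `P`. -/
theorem exists_mem_preimages {a b z w : ℚ} (hP : Affine.Nonsingular ((shortCurve a b)⁄ℚ) z w)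
    (l : AlgebraicClosure ℚ)
    (hl : l ^ 4 + (-6 * algebraMap ℚ _ z) * l ^ 2 + (-8 * algebraMap ℚ _ w) * l +
      (-3 * algebraMap ℚ _ z ^ 2 - 4 * algebraMap ℚ _ a) = 0)
    (hv : halfY (algebraMap ℚ _ z) (algebraMap ℚ _ w) l ≠ 0) :
    ∃ h : Affine.Nonsingular ((shortCurve a b)⁄(AlgebraicClosure ℚ))
        (halfX (algebraMap ℚ _ z) l) (halfY (algebraMap ℚ _ z) (algebraMap ℚ _ w) l),
      Affine.Point.some _ _ h ∈ preimages (shortCurve a b) 2 (Affine.Point.some z w hP) := by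
  have hw := congrArg (algebraMap ℚ (AlgebraicClosure ℚ))
    ((shortCurve_equation_iff a b z w).1 hP.1)
  simp only [map_add, map_mul, map_pow, Algebra.algebraMap_self, RingHom.id_apply] at hw
  have ht := tangent_slope hl
  set u := halfX (algebraMap ℚ _ z) l with hu
  set v := halfY (algebraMap ℚ _ z) (algebraMap ℚ _ w) l with hv'
  have hv2 : v ≠ -v := fun h => hv (by linear_combination (1 / 2) * h)
  have hns : Affine.Nonsingular ((shortCurve a b)⁄(AlgebraicClosure ℚ)) u v := by
    refine (Affine.nonsingular_iff _ _).2 ⟨(shortCurve_equation_iff a b u v).2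
      (halfY_sq hw hl), Or.inr ?_⟩
    simpa [shortCurve, baseChange] using hv2
  refine ⟨hns, ?_⟩
  have hneg : ((shortCurve a b)⁄(AlgebraicClosure ℚ)).toAffine.negY u v = -v := by
    simp [Affine.negY, shortCurve, baseChange]
  have hslope : ((shortCurve a b)⁄(AlgebraicClosure ℚ)).toAffine.slope u u v v = l := by
    rw [Affine.slope_of_Y_ne rfl (by rw [hneg]; exact hv2), hneg, div_eq_iff (by
      intro h; exact hv2 (sub_eq_zero.1 h))]
    simp only [shortCurve, baseChange, map_a₁, map_a₂, map_a₄, map_zero]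
    linear_combination ht
  change 2 • _ = _
  rw [two_nsmul, Affine.Point.add_self_of_Y_ne (by rw [hneg]; exact hv2),
    Affine.Point.baseChange, Affine.Point.map_some]
  simp only [Affine.Point.some.injEq, hslope]
  constructor
  · simp only [Affine.addX, shortCurve, baseChange, map_a₁, map_a₂, map_zero]
    simp only [hu, halfX]
    change _ = algebraMap ℚ _ z
    ring
  · simp only [Affine.addX, Affine.addY, Affine.negAddY, Affine.negY, shortCurve, baseChange,
      map_a₁, map_a₂, map_a₃, map_zero]
    simp only [hu, hv', halfX, halfY]
    change _ = algebraMap ℚ _ w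
    ring

/-- If all permutations of the halves of `P` come from the Galois group, then the ordinates of the
halves are distinct. -/
theorem halfY_injective {a b z w : ℚ} [(shortCurve a b).IsElliptic]
    (hP : Affine.Nonsingular ((shortCurve a b)⁄ℚ) z w)
    (hsurj : Function.Surjective (rho (shortCurve a b) 2 (Affine.Point.some z w hP)))
    {l : Fin 4 → AlgebraicClosure ℚ}
    (hl : ∀ x, x ^ 4 + (-6 * algebraMap ℚ _ z) * x ^ 2 + (-8 * algebraMap ℚ _ w) * x +
      (-3 * algebraMap ℚ _ z ^ 2 - 4 * algebraMap ℚ _ a) = ∏ i, (x - l i))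
    (hlinj : Function.Injective l)
    (hv : ∀ i, halfY (algebraMap ℚ _ z) (algebraMap ℚ _ w) (l i) ≠ 0)
    (hnonconst : ∀ c, ¬ ∀ i, halfY (algebraMap ℚ _ z) (algebraMap ℚ _ w) (l i) = c) :
    Function.Injective fun i => halfY (algebraMap ℚ _ z) (algebraMap ℚ _ w) (l i) := by
  classical
  have hl0 (i : Fin 4) : (l i) ^ 4 + (-6 * algebraMap ℚ _ z) * (l i) ^ 2 +
      (-8 * algebraMap ℚ _ w) * l i +
      (-3 * algebraMap ℚ _ z ^ 2 - 4 * algebraMap ℚ _ a) = 0 :=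
    (hl (l i)).trans (Finset.prod_eq_zero (Finset.mem_univ i) (sub_self _))
  choose hns hmem using fun i => exists_mem_preimages hP (l i) (hl0 i) (hv i)
  let Q (i : Fin 4) : preimages (shortCurve a b) 2 (Affine.Point.some z w hP) := ⟨_, hmem i⟩
  have hQ {i j : Fin 4} (h : Q i = Q j) : i = j := by
    have h' := congrArg Subtype.val h
    simp only [Q, Affine.Point.some.injEq] at h'
    -- As the ordinate is nonzero, the tangency relation recovers the slope from the point.
    have hi := tangent_slope (hl0 i)
    rw [h'.1, h'.2, tangent_slope (hl0 j)] at hi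
    exact (hlinj (mul_right_cancel₀ (mul_ne_zero two_ne_zero (hv j)) hi)).symm
  have hσ (σ : AbsGal) {i j : Fin 4}
      (h : rho (shortCurve a b) 2 (Affine.Point.some z w hP) σ (Q i) = Q j) :
      σ (halfY (algebraMap ℚ _ z) (algebraMap ℚ _ w) (l i)) =
        halfY (algebraMap ℚ _ z) (algebraMap ℚ _ w) (l j) :=
    (Affine.Point.some.inj (congrArg Subtype.val h)).2
  intro i j hij
  by_contra hne
  refine hnonconst (halfY (algebraMap ℚ _ z) (algebraMap ℚ _ w) (l i)) fun k => ?_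
  by_cases hki : k = i
  · rw [hki]
  -- Such a σ fixes the ordinate of `Q i` and carries that of `Q j` to that of `Q k`, so the
  -- equality of the first two forces the third to agree.
  obtain ⟨σ, hs⟩ := hsurj (Equiv.swap (Q j) (Q k))
  have h1 := hσ σ (i := i) (j := i) (by
    rw [hs]
    exact Equiv.swap_apply_of_ne_of_ne (fun h => hne (hQ h)) fun h => hki (hQ h).symm)
  have h2 := hσ σ (i := j) (j := k) (by rw [hs]; exact Equiv.swap_apply_left _ _)
  rw [← h2, ← h1]
  exact congrArg σ hij.symm

theorem mem_rootSet_fPoly {a b z w : ℚ} {r : Fin 4 → AlgebraicClosure ℚ}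
    (h : ∀ y, ∏ i, (y - r i ^ 2) = y ^ 4 - 8 * algebraMap ℚ _ w * y ^ 3 +
      6 * (2 * algebraMap ℚ _ a * algebraMap ℚ _ z + 3 * algebraMap ℚ _ b) * y ^ 2 -
      (4 * algebraMap ℚ _ a ^ 3 + 27 * algebraMap ℚ _ b ^ 2)) (y : AlgebraicClosure ℚ) :
    y ∈ (fPoly a b z w).rootSet (AlgebraicClosure ℚ) ↔ ∃ i, y ^ 2 = r i ^ 2 := by
  have hne : fPoly a b z w ≠ 0 := by
    intro h0
    have := congrArg (Polynomial.coeff · 8) h0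
    simp only [fPoly, Polynomial.coeff_add, Polynomial.coeff_sub, Polynomial.coeff_C_mul,
      Polynomial.coeff_X_pow, Polynomial.coeff_C, Polynomial.coeff_zero] at this
    norm_num at this
  have hev : Polynomial.aeval y (fPoly a b z w) = ∏ i, (y ^ 2 - r i ^ 2) := by
    rw [h (y ^ 2)]
    simp only [fPoly, map_add, map_sub, map_mul, map_pow, Polynomial.aeval_X, Polynomial.aeval_C,
      map_ofNat]
    ring
  rw [Polynomial.mem_rootSet_of_ne hne, hev, Finset.prod_eq_zero_iff]
  simp [sub_eq_zero]

end QuaternionOrigami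

/-- Let `E : y² = x³ + a x + b` be an elliptic curve over `ℚ` and let `P = (z, w)` be a rational
point of `E` other than the origin. If the Galois representation on the four points of `[2]⁻¹P` is
surjective onto the full symmetric group `S₄` of this set, then the Galois group over `ℚ` of the
splitting field of `fPoly a b z w` embeds into the holomorph of `Q₈`, a group of order `192`. -/
theorem mainTheorem1 (a b : ℚ) [(QuaternionOrigami.shortCurve a b).IsElliptic] (z w : ℚ)
    (hP : Affine.Nonsingular ((QuaternionOrigami.shortCurve a b)⁄ℚ) z w)
    (hsurj : Function.Surjective
      (QuaternionOrigami.rho (QuaternionOrigami.shortCurve a b) 2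
        (Affine.Point.some z w hP))) :
    (∃ φ : Gal((QuaternionOrigami.fPoly a b z w).SplittingField/ℚ) →*
        QuaternionOrigami.Holomorph QuaternionOrigami.Q8,
      Function.Injective φ) ∧
    Nat.card (QuaternionOrigami.Holomorph QuaternionOrigami.Q8) = 192 := by
  open QuaternionOrigami in
  refine ⟨?_, card_holomorph_Q8⟩
  have hΔ := (map_ne_zero (algebraMap ℚ (AlgebraicClosure ℚ))).2 (shortCurve_disc_ne_zero a b)
  have hw := congrArg (algebraMap ℚ (AlgebraicClosure ℚ))
    ((shortCurve_equation_iff a b z w).1 hP.1)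
  simp only [map_add, map_mul, map_pow, map_ofNat, Algebra.algebraMap_self, RingHom.id_apply]
    at hw hΔ
  obtain ⟨l, hl⟩ := exists_quartic_roots (-6 * algebraMap ℚ (AlgebraicClosure ℚ) z)
    (-8 * algebraMap ℚ (AlgebraicClosure ℚ) w)
    (-3 * algebraMap ℚ _ z ^ 2 - 4 * algebraMap ℚ _ a)
  choose r hr using fun i => IsAlgClosed.exists_pow_nat_eq
    (halfY (algebraMap ℚ _ z) (algebraMap ℚ _ w) (l i)) two_pos
  have hprod := prod_sub_halfY hw hl
  have hinj := halfY_injective hP hsurj hl (slopes_injective hw hl hΔ)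
  simp only [← hr] at hprod hinj
  obtain ⟨hr2, hdet⟩ := det_oddPowers_eq hw hprod
  have hr0 (i : Fin 4) : r i ^ 2 ≠ 0 :=
    Finset.prod_ne_zero_iff.1 (hr2 ▸ neg_ne_zero.2 hΔ) i (Finset.mem_univ i)
  refine exists_injective_hom_holomorph _ r (mem_rootSet_fPoly hprod)
    (fun i h => hr0 i (by rw [h]; ring)) (hinj hr0 fun c hc => ?_) ?_
  -- If all ordinates equal c, the missing linear term of the ordinate quartic gives 4c³ = 0,
  -- contradicting its nonzero constant term.
  · simp only [hc, Finset.prod_const, Finset.card_univ, Fintype.card_fin] at hprod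
    obtain ⟨-, -, h₃, -⟩ := vieta_quartic (l := fun _ => c) (c₃ := -(8 * algebraMap ℚ _ w))
      (c₂ := 6 * (2 * algebraMap ℚ _ a * algebraMap ℚ _ z + 3 * algebraMap ℚ _ b)) (c₁ := 0)
      (c₀ := -(4 * algebraMap ℚ _ a ^ 3 + 27 * algebraMap ℚ _ b ^ 2)) fun y => by
        rw [Finset.prod_const, Finset.card_univ, Fintype.card_fin, hprod y]; ring
    have hc3 : c ^ 3 = 0 := by linear_combination (1 / 4) * h₃
    exact hr0 0 ((hc 0).trans (pow_eq_zero_iff three_ne_zero |>.1 hc3))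
  · rcases sq_eq_sq_iff_eq_or_eq_neg.1 hdet with h | h
    · exact ⟨(4 * a ^ 3 + 27 * b ^ 2) * (64 * a ^ 3 + 576 * a ^ 2 * z ^ 2 - 1728 * b * z ^ 3),
        by rw [h]; simp⟩
    · exact ⟨-((4 * a ^ 3 + 27 * b ^ 2) * (64 * a ^ 3 + 576 * a ^ 2 * z ^ 2 - 1728 * b * z ^ 3)),
        by rw [h]; simp⟩
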